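/- Let $E$ be a finite non-empty set. For probability measures $\nu_1,\nu_2$ on $E$ put $d_{TV}(\nu_1,\nu_2)=\frac12\sum_{e\in E}|\nu_1(e)-\nu_2(e)|$. Let $q$ and $\bar q$ be probability kernels from $E^{\mathbb N}$ (with the product $\sigma$-field) to $E$ with $q(e\mid y)>0$ and $\bar q(e\mid y)>0$ for all $e\in E$, $y\in E^{\mathbb N}$. For $m\ge 0$ let $$b_m=\sup\{d_{TV}(q(\cdot\mid y),q(\cdot\mid y')) : y,y'\in E^{\mathbb N},\ y_i=y'_i \text{ for } 0\le i\le m-1\},$$ and define $\bar b_m$ in the same way from $\bar q$. Assume that $b_0<1$, $\bar b_0<1$, $b_m\to0$, $\bar b_m\to 0$ and $\sum_{m\ge1}(b_m+\bar b_m)<\infty$. Let $b_0^*=b_0$ and, for $n\ge1$, $b_n^*=\mathbb P(S_n=0)$, where $(S_n)_{n\ge0}$ is the Markov chain on $\mathbb N$ with $S_0=0$ and transition probabilities $P(i,i+1)=1-b_i$, $P(i,0)=b_i$. A stationary chain with transition kernel $q$ is a stationary $E$-valued process $(Y_t)_{t\in\mathbb Z}$ such that, for all $t\in\mathbb Z$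 and $e\in E$, $\mathbb P(Y_t=e\mid Y_{t-1},Y_{t-2},\ldots)=q(e\mid Y_{t-1},Y_{t-2},\ldots)$ almost surely. Then stationary chains with transition kernels $q$ and $\bar q$ exist and each is unique in law; moreover $\sum_{m\ge0}b_m^*<\infty$, and the laws $\pi$ of $Y_0$ and $\bar\pi$ of $\bar Y_0$, where $(Y_t)$ and $(\bar Y_t)$ are stationary chains with transition kernels $q$ and $\bar q$, satisfy $$d_{TV}(\pi,\bar\pi)\le\Bigl(1+\sum_{m\ge0}b_m^*\Bigr)\sup_{y\in E^{\mathbb N}}d_{TV}(q(\cdot\mid y),\bar q(\cdot\mid y)).$$ In the Markov case, where $q(\cdot\mid y)$ depends on $y_0$ only, one has $b_m=0$ and $b_m^*=b_0^m$ for $m\ge1$, $1+\sum_{m\ge1}b_m^*=(1-b_0)^{-1}$, and the classical bound in terms of the ergodicity coefficient $b_0$ holds: $$d_{TV}(\pi,\bar\pi)\le(1-b_0)^{-1}\sup_{y\in E^{\mathbb N}}d_{TV}(q(\cdot\mid y),\bar q(\cdot\mid y)).$$ -/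

import Mathlib

open MeasureTheory ProbabilityTheory Filter Topology

noncomputable section

namespace CompleteConnections

/-- Total variation distance between two (probability) measures on a finite set. -/
def dTV {E : Type*} [Fintype E] [MeasurableSpace E] (ν₁ ν₂ : Measure E) : ℝ :=
  (1 / 2) * ∑ e : E, |ν₁.real {e} - ν₂.real {e}|

/-- The continuity coefficient `b_m` of a kernel `q` from `E^ℕ` to `E`: the supremum of
`dTV (q y) (q y')` over the pairs of pasts with the same `m` most recent coordinates
(`y 0` is the most recent one). -/
def contCoeff {E : Type*} [Fintype E] [MeasurableSpace E]
    (q : Kernel (ℕ → E) E) (m : ℕ) : ℝ :=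
  sSup {r : ℝ | ∃ y y' : ℕ → E, (∀ i < m, y i = y' i) ∧ r = dTV (q y) (q y')}

/-- Positivity of the transition probabilities (measurability is part of `Kernel`). -/
def PositiveKernel {E : Type*} [MeasurableSpace E] (q : Kernel (ℕ → E) E) : Prop :=
  ∀ (y : ℕ → E) (e : E), 0 < (q y).real {e}

/-- `b_0 < 1` and `b_m → 0`. -/
def ContinuousKernel {E : Type*} [Fintype E] [MeasurableSpace E]
    (q : Kernel (ℕ → E) E) : Prop :=
  contCoeff q 0 < 1 ∧ Tendsto (contCoeff q) atTop (𝓝 0)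

/-- The transition matrix on `ℕ` with `P(i, i+1) = 1 - b_i` and `P(i, 0) = b_i`. -/
def houseMatrix (b : ℕ → ℝ) (i j : ℕ) : ℝ :=
  if j = i + 1 then 1 - b i else if j = 0 then b i else 0

/-- `houseLaw b n j = P(S_n = j)` for the Markov chain `(S_n)` on `ℕ` with `S_0 = 0` and
transition matrix `houseMatrix b`. The sums have only finitely many nonzero terms, as
`S_n ≤ n`. -/
def houseLaw (b : ℕ → ℝ) : ℕ → ℕ → ℝ
  | 0, j => if j = 0 then 1 else 0
  | n + 1, j => ∑' i : ℕ, houseLaw b n i * houseMatrix b i j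

/-- `b*_0 = b_0` and `b*_n = P(S_n = 0)` for `n ≥ 1`. -/
def bStar (b : ℕ → ℝ) (n : ℕ) : ℝ :=
  if n = 0 then b 0 else houseLaw b n 0

/-- The past `Y_{t-1}^- = (Y_{t-1}, Y_{t-2}, …)`. -/
def past {Ω E : Type*} (Y : ℤ → Ω → E) (t : ℤ) (ω : Ω) : ℕ → E :=
  fun j => Y (t - 1 - (j : ℤ)) ω

/-- `(Y_t)_{t ∈ ℤ}`, defined on the probability space `(Ω, P)`, is a stationary chain with
complete connections and transition kernel `q`: the law of the process is invariant under time
shifts and `P(Y_t = e | Y_{t-1}, Y_{t-2}, …) = q(e | Y_{t-1}, Y_{t-2}, …)` almost surely. -/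
structure IsStationaryChain {Ω E : Type*} [MeasurableSpace Ω] [MeasurableSpace E]
    (q : Kernel (ℕ → E) E) (P : Measure Ω) (Y : ℤ → Ω → E) : Prop where
  isProbabilityMeasure : IsProbabilityMeasure P
  measurable : ∀ t, Measurable (Y t)
  stationary : ∀ k : ℤ, P.map (fun ω t => Y (t + k) ω) = P.map (fun ω t => Y t ω)
  transition : ∀ (t : ℤ) (e : E),
    P[(Y t ⁻¹' {e}).indicator (fun _ => (1 : ℝ)) | MeasurableSpace.comap (past Y t) inferInstance]
      =ᵐ[P] fun ω => (q (past Y t ω)).real {e}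

end CompleteConnections

end

/-! Regard the process of pasts as a Markov chain, with operator `T f y = ∑ e, q(e|y) f(ey)`, and
follow the modulus `w m` by which `f` varies between pasts sharing `m` recent letters. Couple the
next letters after two such pasts maximally: with probability at least `1 - b m` they agree and the
common stretch grows to `m + 1`; otherwise the error is at most `w 0`. So `T f` has modulus
`houseStep b w` (`HasOsc.map`), and the total oscillation of `T^n f` is at most `E w(S_n)` for the
house-of-cards chain `S` (`iterate_houseStep_zero`).

Summability of `b` and `b 0 < 1` make `∏ (1 - b i)` positive, so `S` is transient: `∑ P(S_n = 0) <
∞` and `P(S_n < k) → 0`. Hence `T^n f` flattens for every local `f`. This gives uniqueness of the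
invariant law of the past and, with compactness, its existence; invariant laws correspond to
stationary chains.

For the perturbation bound let `μ`, `μ'` be invariant for `T`, `T'`. Telescoping `∫ f dμ' - ∫ T^n f
dμ'` yields terms `∫ (T' - T) T^k f dμ'`, each at most `sup dTV(q, qbar)` times the oscillation of
`T^k f`. If `f` is the indicator of an event in the latest letter, that oscillation is at most
`P(S_k = 0)`. The resulting constant `∑ P(S_k = 0) = 1 + ∑_{k ≥ 1} b*_k` is smaller than the stated
one by `b*_0` and is the geometric series in the Markov case. -/

noncomputable section

namespace CompleteConnections

/-! ### The house-of-cards chain -/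

/-- The transition operator of the house-of-cards chain acting on functions. -/
def houseStep (b w : ℕ → ℝ) (m : ℕ) : ℝ := (1 - b m) * w (m + 1) + b m * w 0

lemma houseLaw_eq_zero_of_lt (b : ℕ → ℝ) {n j : ℕ} (h : n < j) : houseLaw b n j = 0 := by
  induction n generalizing j with
  | zero => simp [houseLaw, h.ne']
  | succ n ih =>
    rw [houseLaw]
    refine (tsum_congr fun i => ?_).trans tsum_zero
    rcases lt_or_ge n i with hi | hi
    · rw [ih hi, zero_mul]
    · rw [houseMatrix, if_neg (by omega), if_neg (by omega), mul_zero]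

lemma houseLaw_succ (b : ℕ → ℝ) (n j : ℕ) :
    houseLaw b (n + 1) j = ∑ i ∈ Finset.range (n + 1), houseLaw b n i * houseMatrix b i j := by
  rw [houseLaw]
  refine tsum_eq_sum fun i hi => ?_
  rw [houseLaw_eq_zero_of_lt b (by simpa using hi), zero_mul]

lemma houseLaw_succ_succ (b : ℕ → ℝ) (n j : ℕ) :
    houseLaw b (n + 1) (j + 1) = houseLaw b n j * (1 - b j) := by
  rw [houseLaw, tsum_eq_single j]
  · simp [houseMatrix]
  · intro i hi
    rw [houseMatrix, if_neg (by omega), if_neg (by omega), mul_zero]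

lemma houseLaw_succ_zero (b : ℕ → ℝ) (n : ℕ) :
    houseLaw b (n + 1) 0 = ∑ i ∈ Finset.range (n + 1), houseLaw b n i * b i := by
  rw [houseLaw_succ]
  refine Finset.sum_congr rfl fun i _ => ?_
  simp [houseMatrix]

/-- One-step duality `E w(S_{n+1}) = E (houseStep b w)(S_n)`. -/
lemma sum_houseLaw_succ (b w : ℕ → ℝ) (n : ℕ) :
    ∑ j ∈ Finset.range (n + 2), houseLaw b (n + 1) j * w j =
      ∑ j ∈ Finset.range (n + 1), houseLaw b n j * houseStep b w j := by
  rw [Finset.sum_range_succ', houseLaw_succ_zero, Finset.sum_mul, ← Finset.sum_add_distrib]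
  refine Finset.sum_congr rfl fun j _ => ?_
  rw [houseLaw_succ_succ, houseStep]
  ring

/-- The law of the house-of-cards chain is dual to the iterated transition operator. -/
lemma iterate_houseStep_zero (b w : ℕ → ℝ) (n : ℕ) :
    (houseStep b)^[n] w 0 = ∑ j ∈ Finset.range (n + 1), houseLaw b n j * w j := by
  induction n generalizing w with
  | zero => simp [houseLaw]
  | succ n ih => rw [Function.iterate_succ_apply, ih, sum_houseLaw_succ]

lemma sum_houseLaw (b : ℕ → ℝ) (n : ℕ) : ∑ j ∈ Finset.range (n + 1), houseLaw b n j = 1 := by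
  induction n with
  | zero => simp [houseLaw]
  | succ n ih =>
    have h := sum_houseLaw_succ b (fun _ => 1) n
    simpa [houseStep, ih] using h

lemma houseLaw_nonneg {b : ℕ → ℝ} (hb0 : ∀ m, 0 ≤ b m) (hb1 : ∀ m, b m ≤ 1) (n j : ℕ) :
    0 ≤ houseLaw b n j := by
  induction n generalizing j with
  | zero => rw [houseLaw]; split_ifs <;> norm_num
  | succ n ih =>
    cases j with
    | zero =>
      rw [houseLaw_succ_zero]
      exact Finset.sum_nonneg fun i _ => mul_nonneg (ih i) (hb0 i)
    | succ j =>
      rw [houseLaw_succ_succ]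
      exact mul_nonneg (ih j) (sub_nonneg.2 (hb1 j))

/-- The only way to stand at `j` at time `n + j` is to be at `0` at time `n` and then climb `j`
times. -/
lemma houseLaw_add (b : ℕ → ℝ) (n j : ℕ) :
    houseLaw b (n + j) j = houseLaw b n 0 * ∏ i ∈ Finset.range j, (1 - b i) := by
  induction j with
  | zero => simp
  | succ j ih => rw [← add_assoc, houseLaw_succ_succ, ih, Finset.prod_range_succ, mul_assoc]

/-- The probability that the house-of-cards chain never returns to `0` is positive. -/
lemma exists_pos_le_prod_one_sub {b : ℕ → ℝ} (hb0 : ∀ m, 0 ≤ b m) (hb1 : b 0 < 1)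
    (hanti : Antitone b) (hsum : Summable b) :
    ∃ p : ℝ, 0 < p ∧ ∀ n, p ≤ ∏ i ∈ Finset.range n, (1 - b i) := by
  have hle : ∀ m, b m < 1 := fun m => (hanti (Nat.zero_le m)).trans_lt hb1
  -- Beyond `M` the total mass of `b` is below `1/2`, so the Weierstrass inequality `1 - ∑ b ≤ ∏ (1
  -- - b)` keeps the tail product above `1/2`.
  obtain ⟨M, hM⟩ := ((tendsto_sum_nat_add b).eventually (gt_mem_nhds one_half_pos)).exists
  have hpos : ∀ n, 0 < ∏ i ∈ Finset.range n, (1 - b i) := fun n =>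
    Finset.prod_pos fun i _ => sub_pos.2 (hle i)
  have hsum' : Summable fun k => b (k + M) := (summable_nat_add_iff M).2 hsum
  have key : ∀ n, 1 / 2 ≤ ∏ i ∈ Finset.range n, (1 - b (M + i)) := by
    intro n
    have h1 : ∀ n, 1 - ∑ i ∈ Finset.range n, b (M + i) ≤
        ∏ i ∈ Finset.range n, (1 - b (M + i)) := by
      intro n
      induction n with
      | zero => simp
      | succ n ih =>
        rw [Finset.sum_range_succ, Finset.prod_range_succ]
        have h2 : ∏ i ∈ Finset.range n, (1 - b (M + i)) ≤ 1 :=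
          Finset.prod_le_one (fun i _ => sub_nonneg.2 (hle _).le)
            fun i _ => sub_le_self _ (hb0 _)
        nlinarith [hb0 (M + n)]
    have h3 : ∑ i ∈ Finset.range n, b (M + i) ≤ ∑' k, b (k + M) := by
      simp_rw [add_comm M]
      exact hsum'.sum_le_tsum _ fun i _ => hb0 _
    linarith [h1 n]
  refine ⟨(∏ i ∈ Finset.range M, (1 - b i)) * (1 / 2), mul_pos (hpos M) one_half_pos,
    fun n => ?_⟩
  calc (∏ i ∈ Finset.range M, (1 - b i)) * (1 / 2)
      ≤ (∏ i ∈ Finset.range M, (1 - b i)) * ∏ i ∈ Finset.range n, (1 - b (M + i)) :=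
        mul_le_mul_of_nonneg_left (key n) (hpos M).le
    _ = ∏ i ∈ Finset.range (M + n), (1 - b i) := (Finset.prod_range_add _ _ _).symm
    _ = ∏ i ∈ Finset.range (n + M), (1 - b i) := by rw [add_comm]
    _ ≤ ∏ i ∈ Finset.range n, (1 - b i) := by
        rw [Finset.prod_range_add]
        exact mul_le_of_le_one_right (hpos n).le (Finset.prod_le_one
          (fun i _ => sub_nonneg.2 (hle _).le) fun i _ => sub_le_self _ (hb0 _))

/-- Transience of the house-of-cards chain: the expected number of visits to `0` is finite. -/
lemma summable_houseLaw_zero {b : ℕ → ℝ} (hb0 : ∀ m, 0 ≤ b m) (hb1 : b 0 < 1)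
    (hanti : Antitone b) (hsum : Summable b) : Summable fun n => houseLaw b n 0 := by
  obtain ⟨p, hp, hprod⟩ := exists_pos_le_prod_one_sub hb0 hb1 hanti hsum
  have hle : ∀ m, b m ≤ 1 := fun m => ((hanti (Nat.zero_le m)).trans_lt hb1).le
  have hnn := houseLaw_nonneg hb0 hle
  refine summable_of_sum_range_le (c := 1 / p) (fun n => hnn n 0) fun n => ?_
  rw [le_div_iff₀ hp]
  calc (∑ k ∈ Finset.range n, houseLaw b k 0) * p
      ≤ (∑ k ∈ Finset.range (n + 1), houseLaw b k 0) * p := by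
        rw [Finset.sum_range_succ]
        nlinarith [hnn n 0]
    _ = ∑ j ∈ Finset.range (n + 1), houseLaw b (n - j) 0 * p := by
        rw [Finset.sum_mul, ← Finset.sum_range_reflect]
        simp
    -- Last-visit decomposition: `S_n = j` means a visit to `0` at time `n - j` and no return up to
    -- `n`, which costs a factor at least `p`.
    _ ≤ ∑ j ∈ Finset.range (n + 1), houseLaw b n j := by
        refine Finset.sum_le_sum fun j hj => ?_
        have hj' : j ≤ n := by simpa [Nat.lt_succ_iff] using hj
        have h := houseLaw_add b (n - j) j
        rw [Nat.sub_add_cancel hj'] at h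
        rw [h]
        exact mul_le_mul_of_nonneg_left (hprod j) (hnn _ _)
    _ = 1 := sum_houseLaw b n

lemma tendsto_houseLaw {b : ℕ → ℝ} (hu : Summable fun n => houseLaw b n 0) (j : ℕ) :
    Tendsto (fun n => houseLaw b n j) atTop (𝓝 0) := by
  rw [← tendsto_add_atTop_iff_nat j]
  simp_rw [houseLaw_add]
  simpa using hu.tendsto_atTop_zero.mul_const (∏ i ∈ Finset.range j, (1 - b i))

/-- If `w` has finite support, the iterates of the transition operator tend to `0` at `0`. -/
lemma tendsto_iterate_houseStep {b : ℕ → ℝ}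
    (hu : Summable fun n => houseLaw b n 0) {w : ℕ → ℝ} {k : ℕ} (hw : ∀ j, k ≤ j → w j = 0) :
    Tendsto (fun n => (houseStep b)^[n] w 0) atTop (𝓝 0) := by
  have h : Tendsto (fun n => ∑ j ∈ Finset.range k, houseLaw b n j * w j) atTop (𝓝 0) := by
    have := tendsto_finsetSum (Finset.range k) fun j _ =>
      (tendsto_houseLaw hu j).mul_const (w j)
    simpa using this
  refine h.congr' ?_
  filter_upwards [eventually_ge_atTop k] with n hn
  rw [iterate_houseStep_zero]
  refine Finset.sum_subset (Finset.range_mono (by omega)) fun j _ hj => ?_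
  rw [hw j (by simpa using hj), mul_zero]

/-- The decrement at `m` is `(1 - b (m+1)) (w (m+1) - w (m+2)) + (b m - b (m+1)) (w 0 - w (m+1))`.
-/
lemma antitone_houseStep {b w : ℕ → ℝ} (hb1 : ∀ m, b m ≤ 1) (hb : Antitone b)
    (hw : Antitone w) : Antitone (houseStep b w) := by
  refine antitone_nat_of_succ_le fun m => ?_
  have h1 := hb (Nat.le_succ m)
  have h2 := hw (Nat.le_succ (m + 1))
  have h3 := hw (Nat.zero_le (m + 1))
  have h4 := hb1 (m + 1)
  simp only [houseStep, Nat.succ_eq_add_one] at *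
  nlinarith [mul_nonneg (sub_nonneg.2 h1) (sub_nonneg.2 h3),
    mul_nonneg (sub_nonneg.2 h4) (sub_nonneg.2 h2)]

lemma summable_bStar {b : ℕ → ℝ} (hu : Summable fun n => houseLaw b n 0) :
    Summable (bStar b) := by
  rw [← summable_nat_add_iff 1] at hu ⊢
  exact hu.congr fun n => by simp [bStar]

/-- The expected number of visits to `0`, in terms of `bStar`. -/
lemma tsum_houseLaw_zero {b : ℕ → ℝ} (hu : Summable fun n => houseLaw b n 0) :
    ∑' n, houseLaw b n 0 = 1 + ∑' n, bStar b (n + 1) := by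
  rw [hu.tsum_eq_zero_add]
  simp [houseLaw, bStar]

/-- If `b m = 0` for `m ≥ 1`, the chain is at `0` only if it has never left it. -/
lemma houseLaw_zero_of_eq_zero {b : ℕ → ℝ} (hb : ∀ m, 1 ≤ m → b m = 0) (n : ℕ) :
    houseLaw b n 0 = b 0 ^ n := by
  induction n with
  | zero => simp [houseLaw]
  | succ n ih =>
    rw [houseLaw_succ_zero, Finset.sum_range_succ', ih, pow_succ]
    simp [hb]

/-! ### Total variation distance and continuity coefficients -/

section TotalVariation

variable {E : Type*} [Fintype E]

/-- This is the mass that a maximal coupling puts on the diagonal. -/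
lemma sum_min_eq {p p' : E → ℝ} (hp : ∑ e, p e = 1) (hp' : ∑ e, p' e = 1) :
    ∑ e, min (p e) (p' e) = 1 - 1 / 2 * ∑ e, |p e - p' e| := by
  have h : ∀ e, min (p e) (p' e) = 1 / 2 * (p e + p' e - |p e - p' e|) := fun e => by
    have h1 := min_add_max (p e) (p' e)
    have h2 := max_sub_min_eq_abs' (p e) (p' e)
    linarith
  simp_rw [h, ← Finset.mul_sum, Finset.sum_sub_distrib, Finset.sum_add_distrib, hp, hp']
  ring

/-- Integrals of two functions that are `c`-close on the diagonal and `C`-close off it. -/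
lemma sum_mul_sub_sum_mul_le [Nonempty E] {p p' f f' : E → ℝ} {c C : ℝ}
    (hp : ∑ e, p e = 1) (hp' : ∑ e, p' e = 1) (hp0 : ∀ e, 0 ≤ p e) (hp0' : ∀ e, 0 ≤ p' e)
    (hc : ∀ e, f e - f' e ≤ c) (hC : ∀ e e', f e - f' e' ≤ C) :
    ∑ e, p e * f e - ∑ e, p' e * f' e ≤
      (1 - 1 / 2 * ∑ e, |p e - p' e|) * c + (1 / 2 * ∑ e, |p e - p' e|) * C := by
  have hm := sum_min_eq hp hp'
  set d := 1 / 2 * ∑ e, |p e - p' e| with hd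
  have hd0 : 0 ≤ d := by positivity
  -- The common part `min p p'` is paired diagonally. Both excesses have mass `d`; bounding them by
  -- the extreme values of `f` and `f'` avoids constructing a coupling.
  obtain ⟨e₁, h₁⟩ := Finite.exists_max f
  obtain ⟨e₂, h₂⟩ := Finite.exists_min f'
  have hA : ∑ e, min (p e) (p' e) * (f e - f' e) ≤ (1 - d) * c := by
    rw [← hm, Finset.sum_mul]
    exact Finset.sum_le_sum fun e _ =>
      mul_le_mul_of_nonneg_left (hc e) (le_min (hp0 e) (hp0' e))
  have hB : ∑ e, (p e - min (p e) (p' e)) * f e ≤ d * f e₁ := by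
    have : d = ∑ e, (p e - min (p e) (p' e)) := by rw [Finset.sum_sub_distrib, hm, hp]; ring
    rw [this, Finset.sum_mul]
    exact Finset.sum_le_sum fun e _ =>
      mul_le_mul_of_nonneg_left (h₁ e) (sub_nonneg.2 (min_le_left _ _))
  have hB' : d * f' e₂ ≤ ∑ e, (p' e - min (p e) (p' e)) * f' e := by
    have : d = ∑ e, (p' e - min (p e) (p' e)) := by rw [Finset.sum_sub_distrib, hm, hp']; ring
    rw [this, Finset.sum_mul]
    exact Finset.sum_le_sum fun e _ =>
      mul_le_mul_of_nonneg_left (h₂ e) (sub_nonneg.2 (min_le_right _ _))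
  have hsplit : ∑ e, p e * f e - ∑ e, p' e * f' e =
      ∑ e, min (p e) (p' e) * (f e - f' e) + ∑ e, (p e - min (p e) (p' e)) * f e
        - ∑ e, (p' e - min (p e) (p' e)) * f' e := by
    rw [← Finset.sum_sub_distrib, ← Finset.sum_add_distrib, ← Finset.sum_sub_distrib]
    exact Finset.sum_congr rfl fun e _ => by ring
  have := mul_le_mul_of_nonneg_left (hC e₁ e₂) hd0
  linarith

/-- The positive and negative parts of `p - p'` have equal mass. Hence the event `{p' ≤ p}` attains
the distance, and one-sided bounds on events suffice. -/
lemma half_sum_abs_sub_eq {p p' : E → ℝ} (hp : ∑ e, p e = 1) (hp' : ∑ e, p' e = 1) :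
    1 / 2 * ∑ e, |p e - p' e| = ∑ e with p' e ≤ p e, (p e - p' e) := by
  have h0 : ∑ e, (p e - p' e) = 0 := by rw [Finset.sum_sub_distrib, hp, hp', sub_self]
  have h1 := Finset.sum_filter_add_sum_filter_not Finset.univ (fun e => p' e ≤ p e)
    (fun e => p e - p' e)
  have h2 := Finset.sum_filter_add_sum_filter_not Finset.univ (fun e => p' e ≤ p e)
    (fun e => |p e - p' e|)
  have h3 : ∑ e with p' e ≤ p e, |p e - p' e| = ∑ e with p' e ≤ p e, (p e - p' e) :=
    Finset.sum_congr rfl fun e he => abs_of_nonneg (sub_nonneg.2 (Finset.mem_filter.1 he).2)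
  have h4 : ∑ e with ¬ p' e ≤ p e, |p e - p' e| = -∑ e with ¬ p' e ≤ p e, (p e - p' e) := by
    rw [← Finset.sum_neg_distrib]
    exact Finset.sum_congr rfl fun e he =>
      abs_of_neg (sub_neg.2 (not_le.1 (Finset.mem_filter.1 he).2))
  linarith

variable [MeasurableSpace E]

lemma dTV_self (ν : Measure E) : dTV ν ν = 0 := by simp [dTV]

lemma dTV_nonneg (ν ν' : Measure E) : 0 ≤ dTV ν ν' := by unfold dTV; positivity

lemma dTV_comm (ν ν' : Measure E) : dTV ν ν' = dTV ν' ν := by simp [dTV, abs_sub_comm]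

lemma contCoeff_le [Nonempty E] (q : Kernel (ℕ → E) E) {m : ℕ} {r : ℝ}
    (h : ∀ y y' : ℕ → E, (∀ i < m, y i = y' i) → dTV (q y) (q y') ≤ r) : contCoeff q m ≤ r := by
  obtain ⟨e⟩ := ‹Nonempty E›
  refine csSup_le ⟨_, fun _ => e, fun _ => e, fun _ _ => rfl, rfl⟩ ?_
  rintro _ ⟨y, y', hy, rfl⟩
  exact h y y' hy

variable [DiscreteMeasurableSpace E]

lemma sum_real_singleton (ν : Measure E) [IsProbabilityMeasure ν] :
    ∑ e, ν.real {e} = 1 := by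
  simp

lemma dTV_le_one (ν ν' : Measure E) [IsProbabilityMeasure ν] [IsProbabilityMeasure ν'] :
    dTV ν ν' ≤ 1 := by
  have h := sum_min_eq (sum_real_singleton ν) (sum_real_singleton ν')
  have : 0 ≤ ∑ e, min (ν.real {e}) (ν'.real {e}) :=
    Finset.sum_nonneg fun e _ => le_min measureReal_nonneg measureReal_nonneg
  rw [dTV]
  linarith

lemma dTV_le_of_forall {ν ν' : Measure E} [IsProbabilityMeasure ν] [IsProbabilityMeasure ν']
    {D : ℝ} (h : ∀ A : Set E, ν.real A - ν'.real A ≤ D) : dTV ν ν' ≤ D := by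
  rw [dTV, half_sum_abs_sub_eq (sum_real_singleton ν) (sum_real_singleton ν'),
    Finset.sum_sub_distrib, sum_measureReal_singleton, sum_measureReal_singleton]
  exact h _

variable (q : Kernel (ℕ → E) E) [IsMarkovKernel q]

lemma bddAbove_contCoeff (m : ℕ) :
    BddAbove {r : ℝ | ∃ y y' : ℕ → E, (∀ i < m, y i = y' i) ∧ r = dTV (q y) (q y')} :=
  ⟨1, by rintro _ ⟨y, y', -, rfl⟩; exact dTV_le_one _ _⟩

lemma dTV_le_contCoeff {m : ℕ} {y y' : ℕ → E} (h : ∀ i < m, y i = y' i) :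
    dTV (q y) (q y') ≤ contCoeff q m :=
  le_csSup (bddAbove_contCoeff q m) ⟨y, y', h, rfl⟩

lemma contCoeff_nonneg [Nonempty E] (m : ℕ) : 0 ≤ contCoeff q m := by
  obtain ⟨e⟩ := ‹Nonempty E›
  exact (dTV_nonneg _ _).trans
    (dTV_le_contCoeff q (y := fun _ => e) (y' := fun _ => e) fun _ _ => rfl)

lemma contCoeff_le_one [Nonempty E] (m : ℕ) : contCoeff q m ≤ 1 :=
  contCoeff_le q fun _ _ _ => dTV_le_one _ _

lemma antitone_contCoeff [Nonempty E] : Antitone (contCoeff q) := fun _ _ hmn =>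
  contCoeff_le q fun _ _ hy => dTV_le_contCoeff q fun i hi => hy i (hi.trans_le hmn)

end TotalVariation

/-! ### The transition operator and oscillations -/

section Oscillation

variable {E : Type*}

/-- The past obtained by adding the letter `e` in front of the past `y`. -/
def pastCons (e : E) (y : ℕ → E) : ℕ → E := fun n => Nat.casesOn n e y

@[simp] lemma pastCons_zero (e : E) (y : ℕ → E) : pastCons e y 0 = e := rfl

@[simp] lemma pastCons_succ (e : E) (y : ℕ → E) (n : ℕ) : pastCons e y (n + 1) = y n := rfl

/-- `f` varies by at most `w m` between pasts with the same `m` most recent coordinates. -/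
def HasOsc (f : (ℕ → E) → ℝ) (w : ℕ → ℝ) : Prop :=
  ∀ (m : ℕ) (y y' : ℕ → E), (∀ i < m, y i = y' i) → f y - f y' ≤ w m

lemma HasOsc.abs_sub_le {f : (ℕ → E) → ℝ} {w : ℕ → ℝ} (h : HasOsc f w) {m : ℕ}
    {y y' : ℕ → E} (hy : ∀ i < m, y i = y' i) : |f y - f y'| ≤ w m :=
  abs_sub_le_iff.2 ⟨h m y y' hy, h m y' y fun i hi => (hy i hi).symm⟩

lemma HasOsc.exists_abs_le {f : (ℕ → E) → ℝ} {w : ℕ → ℝ} (h : HasOsc f w) :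
    ∃ C, ∀ y, |f y| ≤ C := by
  rcases isEmpty_or_nonempty (ℕ → E) with hE | ⟨⟨y₀⟩⟩
  · exact ⟨0, fun y => hE.elim y⟩
  refine ⟨w 0 + |f y₀|, fun y => ?_⟩
  have h1 := h.abs_sub_le (m := 0) (y := y) (y' := y₀) (by simp)
  have h2 := abs_sub_abs_le_abs_sub (f y) (f y₀)
  linarith

/-- A crude modulus for non-local events, for use where only boundedness matters. -/
lemma hasOsc_indicator_const (s : Set (ℕ → E)) :
    HasOsc (s.indicator fun _ => (1 : ℝ)) fun _ => 1 := by
  intro m y y' _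
  by_cases h : y ∈ s <;> by_cases h' : y' ∈ s <;> simp [h, h']

variable [MeasurableSpace E]

lemma measurable_pastCons (e : E) : Measurable (pastCons e) := by
  refine measurable_pi_lambda _ fun n => ?_
  cases n with
  | zero => exact measurable_const
  | succ n => exact measurable_pi_apply n

lemma HasOsc.integrable {f : (ℕ → E) → ℝ} {w : ℕ → ℝ} (hf : HasOsc f w) (hm : Measurable f)
    (μ : Measure (ℕ → E)) [IsFiniteMeasure μ] : Integrable f μ := by
  obtain ⟨C, hC⟩ := hf.exists_abs_le
  exact Integrable.of_bound hm.aestronglyMeasurable C (ae_of_all _ hC)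

variable [Fintype E]

/-- The transition operator of the chain on functions of the past. -/
def transOp (q : Kernel (ℕ → E) E) (f : (ℕ → E) → ℝ) (y : ℕ → E) : ℝ :=
  ∑ e, (q y).real {e} * f (pastCons e y)

variable [DiscreteMeasurableSpace E]

lemma measurable_transOp (q : Kernel (ℕ → E) E) {f : (ℕ → E) → ℝ} (hf : Measurable f) :
    Measurable (transOp q f) := by
  unfold transOp
  refine Finset.measurable_sum _ fun e _ => ?_
  exact (q.measurable_coe (measurableSet_singleton e)).ennreal_toReal.mul
    (hf.comp (measurable_pastCons e))

lemma measurable_iterate_transOp (q : Kernel (ℕ → E) E) {f : (ℕ → E) → ℝ} (hf : Measurable f) (n : ℕ) :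
    Measurable ((transOp q)^[n] f) := by
  induction n generalizing f with
  | zero => exact hf
  | succ n ih => exact ih (measurable_transOp q hf)

variable (q : Kernel (ℕ → E) E) [IsMarkovKernel q]

/-- If the added letters agree, the pasts share `m + 1` coordinates; if not, only `w 0` is
available. Since `w (m + 1) ≤ w 0`, the disagreement probability may be raised to `contCoeff q m`.
-/
lemma HasOsc.map [Nonempty E] {f : (ℕ → E) → ℝ} {w : ℕ → ℝ} (hf : HasOsc f w)
    (hw : Antitone w) : HasOsc (transOp q f) (houseStep (contCoeff q) w) := by
  intro m y y' hy
  have h := sum_mul_sub_sum_mul_le (f := fun e => f (pastCons e y))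
    (f' := fun e => f (pastCons e y')) (c := w (m + 1)) (C := w 0)
    (sum_real_singleton (q y)) (sum_real_singleton (q y'))
    (fun _ => measureReal_nonneg) (fun _ => measureReal_nonneg)
    (fun e => hf _ _ _ fun i hi => by
      cases i with
      | zero => rfl
      | succ i => exact hy i (by omega))
    (fun e e' => hf _ _ _ (by simp))
  have hd : dTV (q y) (q y') ≤ contCoeff q m := dTV_le_contCoeff q hy
  have hww := hw (Nat.zero_le (m + 1))
  refine h.trans ?_
  change (1 - dTV (q y) (q y')) * w (m + 1) + dTV (q y) (q y') * w 0 ≤ _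
  rw [houseStep]
  nlinarith [mul_nonneg (sub_nonneg.2 hd) (sub_nonneg.2 hww)]

lemma HasOsc.iterate [Nonempty E] {f : (ℕ → E) → ℝ} {w : ℕ → ℝ} (hf : HasOsc f w)
    (hw : Antitone w) (n : ℕ) :
    HasOsc ((transOp q)^[n] f) ((houseStep (contCoeff q))^[n] w) := by
  induction n generalizing f w with
  | zero => exact hf
  | succ n ih =>
    exact ih (hf.map q hw)
      (antitone_houseStep (contCoeff_le_one q) (antitone_contCoeff q) hw)

/-- Two transition operators differ by at most the total variation distance of the kernels. -/
lemma transOp_sub_transOp_le [Nonempty E] (q' : Kernel (ℕ → E) E) [IsMarkovKernel q']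
    {f : (ℕ → E) → ℝ} {w : ℕ → ℝ} (hf : HasOsc f w) (y : ℕ → E) :
    transOp q' f y - transOp q f y ≤
      dTV (q y) (q' y) * w 0 := by
  have h := sum_mul_sub_sum_mul_le (f := fun e => f (pastCons e y))
    (f' := fun e => f (pastCons e y)) (c := 0) (C := w 0)
    (sum_real_singleton (q' y)) (sum_real_singleton (q y))
    (fun _ => measureReal_nonneg) (fun _ => measureReal_nonneg)
    (fun e => by simp) (fun e e' => hf _ _ _ (by simp))
  rw [dTV_comm]
  simpa [dTV, transOp] using h

lemma abs_transOp_sub_le [Nonempty E] {f : (ℕ → E) → ℝ} {w : ℕ → ℝ} (hf : HasOsc f w) (y : ℕ → E) :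
    |transOp q f y - f y| ≤ w 0 := by
  have h1 : transOp q f y - f y =
      ∑ e, (q y).real {e} * (f (pastCons e y) - f y) := by
    simp_rw [mul_sub, Finset.sum_sub_distrib, ← Finset.sum_mul, sum_real_singleton, one_mul]
    rfl
  rw [h1]
  calc |∑ e, (q y).real {e} * (f (pastCons e y) - f y)|
      ≤ ∑ e, |(q y).real {e} * (f (pastCons e y) - f y)| := Finset.abs_sum_le_sum_abs _ _
    _ ≤ ∑ e, (q y).real {e} * w 0 := Finset.sum_le_sum fun e _ => by
        rw [abs_mul, abs_of_nonneg measureReal_nonneg]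
        exact mul_le_mul_of_nonneg_left (hf.abs_sub_le (by simp)) measureReal_nonneg
    _ = w 0 := by rw [← Finset.sum_mul, sum_real_singleton, one_mul]

end Oscillation

/-! ### Measures on sequence spaces -/

section SequenceSpace

variable {ι E : Type*} [MeasurableSpace E]

lemma measure_ext_of_map_restrict {μ ν : Measure (ι → E)} [IsFiniteMeasure ν]
    (h : ∀ I : Finset ι, μ.map I.restrict = ν.map I.restrict) : μ = ν :=
  IsProjectiveLimit.unique (P := fun I => ν.map I.restrict) h fun _ => rfl

/-- Sequential compactness along an ultrafilter of the probability measures on `ι → E`, tested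
against the functions that are uniformly approximated by functions of finitely many coordinates. -/
lemma exists_tendsto_integral_hyperfilter [Finite E] [DiscreteMeasurableSpace E] [Countable ι]
    (μ : ℕ → Measure (ι → E)) [∀ n, IsProbabilityMeasure (μ n)] :
    ∃ ν : Measure (ι → E), IsProbabilityMeasure ν ∧ ∀ f : (ι → E) → ℝ,
      (∀ ε > 0, ∃ I : Finset ι, ∀ x y, (∀ i ∈ I, x i = y i) → |f x - f y| < ε) →
      Tendsto (fun n => ∫ x, f x ∂μ n) (hyperfilter ℕ) (𝓝 (∫ x, f x ∂ν)) := by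
  let _ : TopologicalSpace E := ⊥
  have : DiscreteTopology E := ⟨rfl⟩
  let m : ℕ → ProbabilityMeasure (ι → E) := fun n => ⟨μ n, inferInstance⟩
  let U : Ultrafilter (ProbabilityMeasure (ι → E)) := (hyperfilter ℕ).map m
  refine ⟨U.lim, inferInstance, fun f hf => ?_⟩
  -- With `E` finite and discrete, the sequence space is compact, hence so is its space of
  -- probability measures, and every ultrafilter converges.
  have hU : Tendsto m (hyperfilter ℕ) (𝓝 U.lim) := U.le_nhds_lim
  rw [ProbabilityMeasure.tendsto_iff_forall_integral_tendsto] at hU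
  have hcont : Continuous f := by
    refine continuous_iff_continuousAt.2 fun x => Metric.tendsto_nhds.2 fun ε hε => ?_
    obtain ⟨I, hI⟩ := hf ε hε
    have hnhds : ∀ᶠ y in 𝓝 x, ∀ i ∈ I, y i = x i :=
      (Finset.eventually_all I).2 fun i _ =>
        (continuous_apply i).continuousAt.eventually
          (show ∀ᶠ e in 𝓝 (x i), e = x i by simp)
    filter_upwards [hnhds] with y hy
    exact hI y x hy
  exact hU (BoundedContinuousFunction.mkOfCompact ⟨f, hcont⟩)

end SequenceSpace

/-! ### Invariant laws of the past: comparison, uniqueness, existence -/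

section Invariant

variable {E : Type*}

/-- The oscillations of the functions of `k` coordinates with oscillation at most `1`. -/
def cylinderOsc (k j : ℕ) : ℝ := if j < k then 1 else 0

lemma antitone_cylinderOsc (k : ℕ) : Antitone (cylinderOsc k) := by
  intro i j hij
  simp only [cylinderOsc]
  split_ifs <;> first | omega | norm_num

lemma hasOsc_indicator {k : ℕ} {s : Set (ℕ → E)}
    (hs : ∀ y y', (∀ i < k, y i = y' i) → y ∈ s → y' ∈ s) :
    HasOsc (s.indicator fun _ => (1 : ℝ)) (cylinderOsc k) := by
  intro m y y' hy
  by_cases h : y ∈ s <;> by_cases h' : y' ∈ s <;> simp only [h, h', Set.indicator_of_mem,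
    Set.indicator_of_notMem, not_false_eq_true, cylinderOsc, sub_self] <;> split_ifs with hm <;>
    try norm_num
  exact h' (hs y y' (fun i hi => hy i (by omega)) h)

/-- Functions with vanishing oscillation at infinity are uniform limits of local functions. -/
lemma HasOsc.exists_finset {f : (ℕ → E) → ℝ} {w : ℕ → ℝ} (hf : HasOsc f w)
    (hw : Tendsto w atTop (𝓝 0)) {ε : ℝ} (hε : 0 < ε) :
    ∃ I : Finset ℕ, ∀ x y, (∀ i ∈ I, x i = y i) → |f x - f y| < ε := by
  obtain ⟨m, hm⟩ := (hw.eventually (gt_mem_nhds hε)).exists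
  exact ⟨Finset.range m, fun x y hxy =>
    (hf.abs_sub_le fun i hi => hxy i (Finset.mem_range.2 hi)).trans_lt hm⟩

variable [MeasurableSpace E]

/-- A finite measure on the space of pasts is determined by the integrals of the functions of
finitely many coordinates. -/
lemma measure_ext_of_integral_hasOsc [Finite E] [DiscreteMeasurableSpace E]
    {μ ν : Measure (ℕ → E)} [IsFiniteMeasure μ] [IsFiniteMeasure ν]
    (h : ∀ (k : ℕ) (f : (ℕ → E) → ℝ), Measurable f → HasOsc f (cylinderOsc k) →
      ∫ y, f y ∂μ = ∫ y, f y ∂ν) : μ = ν := by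
  refine measure_ext_of_map_restrict fun I => Measure.ext_of_measureReal_singleton fun x => ?_
  have hmeas : Measurable (I.restrict : (ℕ → E) → I → E) := by fun_prop
  have hs : MeasurableSet ((I.restrict : (ℕ → E) → I → E) ⁻¹' {x}) :=
    hmeas (measurableSet_singleton x)
  rw [map_measureReal_apply hmeas (measurableSet_singleton x),
    map_measureReal_apply hmeas (measurableSet_singleton x),
    ← integral_indicator_one hs, ← integral_indicator_one hs]
  refine h (I.sup id + 1) _ (measurable_const.indicator hs) (hasOsc_indicator ?_)
  intro y y' hy hys
  simp only [Set.mem_preimage, Set.mem_singleton_iff] at hys ⊢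
  rw [← hys]
  funext i
  exact (hy i (Nat.lt_succ_of_le (Finset.le_sup (f := id) i.2))).symm

lemma HasOsc.integral_sub_integral_le {f : (ℕ → E) → ℝ} {w : ℕ → ℝ} (hf : HasOsc f w)
    (hm : Measurable f) (μ ν : Measure (ℕ → E)) [IsProbabilityMeasure μ]
    [IsProbabilityMeasure ν] : ∫ y, f y ∂μ - ∫ y, f y ∂ν ≤ w 0 := by
  have h1 : ∀ y', ∫ y, f y ∂μ - w 0 ≤ f y' := fun y' => by
    have : ∫ y, f y ∂μ ≤ ∫ _, (f y' + w 0) ∂μ :=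
      integral_mono (hf.integrable hm μ) (integrable_const _) fun y => by
        have := hf 0 y y' (by simp)
        linarith
    simp only [integral_const, probReal_univ, smul_eq_mul, one_mul] at this
    linarith
  have h2 : ∫ _, (∫ y, f y ∂μ - w 0) ∂ν ≤ ∫ y, f y ∂ν :=
    integral_mono (integrable_const _) (hf.integrable hm ν) h1
  simp only [integral_const, probReal_univ, smul_eq_mul, one_mul] at h2
  linarith

lemma measurable_pastCons_prod :
    Measurable fun p : E × (ℕ → E) => pastCons p.1 p.2 := by
  refine measurable_pi_lambda _ fun n => ?_
  cases n with
  | zero => exact measurable_fst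
  | succ n => exact (measurable_pi_apply n).comp measurable_snd

/-- The Markov kernel on pasts that adds a letter drawn from `q`. -/
def pastKernel (q : Kernel (ℕ → E) E) : Kernel (ℕ → E) (ℕ → E) :=
  (q ×ₖ Kernel.id).map fun p => pastCons p.1 p.2

instance (q : Kernel (ℕ → E) E) [IsMarkovKernel q] : IsMarkovKernel (pastKernel q) :=
  Kernel.IsMarkovKernel.map _ measurable_pastCons_prod

variable [Fintype E] [DiscreteMeasurableSpace E]

lemma integral_pastKernel (q : Kernel (ℕ → E) E) [IsMarkovKernel q] {f : (ℕ → E) → ℝ}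
    (hf : Measurable f) (y : ℕ → E) : ∫ z, f z ∂pastKernel q y = transOp q f y := by
  rw [pastKernel, Kernel.map_apply _ measurable_pastCons_prod, Kernel.prod_apply,
    Kernel.id_apply, Measure.prod_dirac,
    integral_map measurable_pastCons_prod.aemeasurable hf.aestronglyMeasurable,
    integral_map (φ := fun e : E => (e, y)) (by fun_prop)
      (f := fun p => f (pastCons p.1 p.2))
      (hf.comp measurable_pastCons_prod).aestronglyMeasurable,
    integral_fintype Integrable.of_finite]
  rfl

lemma integral_bind_pastKernel (q : Kernel (ℕ → E) E) [IsMarkovKernel q]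
    (μ : Measure (ℕ → E)) [IsProbabilityMeasure μ] {f : (ℕ → E) → ℝ} {w : ℕ → ℝ}
    (hf : HasOsc f w) (hm : Measurable f) :
    ∫ y, f y ∂(μ.bind (pastKernel q)) = ∫ y, transOp q f y ∂μ := by
  have h : μ.bind (pastKernel q) = (pastKernel q ∘ₖ Kernel.const Unit μ) () := by
    rw [Kernel.comp_apply, Kernel.const_apply]
  rw [h, Kernel.integral_comp (hf.integrable hm _), Kernel.const_apply]
  simp_rw [integral_pastKernel q hm]

variable [Nonempty E]

lemma integral_iterate_transOp {q : Kernel (ℕ → E) E} [IsMarkovKernel q]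
    {μ : Measure (ℕ → E)} [IsProbabilityMeasure μ] (hμ : (pastKernel q).Invariant μ)
    {f : (ℕ → E) → ℝ} {w : ℕ → ℝ} (hf : HasOsc f w) (hw : Antitone w) (hm : Measurable f)
    (n : ℕ) : ∫ y, (transOp q)^[n] f y ∂μ = ∫ y, f y ∂μ := by
  induction n with
  | zero => rfl
  | succ n ih =>
    rw [Function.iterate_succ_apply', ← integral_bind_pastKernel q μ (hf.iterate q hw n)
      (measurable_iterate_transOp q hm n), hμ.def, ih]

lemma antitone_iterate_houseStep_contCoeff (q : Kernel (ℕ → E) E) [IsMarkovKernel q]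
    {w : ℕ → ℝ} (hw : Antitone w) (n : ℕ) : Antitone ((houseStep (contCoeff q))^[n] w) := by
  induction n with
  | zero => exact hw
  | succ n ih =>
    rw [Function.iterate_succ_apply']
    exact antitone_houseStep (contCoeff_le_one q) (antitone_contCoeff q) ih

/-- Comparison of the invariant measures of two kernels. -/
lemma integral_sub_integral_le_of_invariant {q q' : Kernel (ℕ → E) E} [IsMarkovKernel q]
    [IsMarkovKernel q'] {μ μ' : Measure (ℕ → E)} [IsProbabilityMeasure μ]
    [IsProbabilityMeasure μ'] (hμ : (pastKernel q).Invariant μ)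
    (hμ' : (pastKernel q').Invariant μ') {f : (ℕ → E) → ℝ} {w : ℕ → ℝ} (hf : HasOsc f w)
    (hw : Antitone w) (hm : Measurable f) {δ : ℝ} (hδ : ∀ y, dTV (q y) (q' y) ≤ δ) (n : ℕ) :
    ∫ y, f y ∂μ' - ∫ y, f y ∂μ ≤
      δ * ∑ k ∈ Finset.range n, (houseStep (contCoeff q))^[k] w 0 +
        (houseStep (contCoeff q))^[n] w 0 := by
  have hosc := hf.iterate q hw
  have hmeas := measurable_iterate_transOp q hm
  -- Invariance of `μ'` allows one `q'`-step to be inserted in the first integral, leaving a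
  -- difference of two operators applied to the same function.
  have hstep : ∀ k, ∫ y, (transOp q)^[k] f y ∂μ' - ∫ y, (transOp q)^[k + 1] f y ∂μ' ≤
      δ * (houseStep (contCoeff q))^[k] w 0 := by
    intro k
    have hk0 : 0 ≤ (houseStep (contCoeff q))^[k] w 0 := by
      simpa using hosc k 0 (fun _ => Classical.arbitrary E) _ fun _ _ => rfl
    have hinv : ∫ y, (transOp q)^[k] f y ∂μ' = ∫ y, transOp q' ((transOp q)^[k] f) y ∂μ' := by
      rw [← integral_bind_pastKernel q' μ' (hosc k) (hmeas k), hμ'.def]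
    have hint := ((hosc k).map q' (antitone_iterate_houseStep_contCoeff q hw k)).integrable
      (measurable_transOp q' (hmeas k)) μ'
    have hint' := (hosc (k + 1)).integrable (hmeas (k + 1)) μ'
    rw [hinv, ← integral_sub hint hint']
    have : ∫ y, (transOp q' ((transOp q)^[k] f) y - (transOp q)^[k + 1] f y) ∂μ' ≤
        ∫ _, δ * (houseStep (contCoeff q))^[k] w 0 ∂μ' := by
      refine integral_mono (hint.sub hint') (integrable_const _) fun y => ?_
      rw [Function.iterate_succ_apply']
      exact (transOp_sub_transOp_le q q' (hosc k) y).trans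
        (mul_le_mul_of_nonneg_right (hδ y) hk0)
    simpa using this
  have htel := Finset.sum_le_sum fun k (_ : k ∈ Finset.range n) => hstep k
  rw [Finset.sum_range_sub', ← Finset.mul_sum] at htel
  have hend := (hosc n).integral_sub_integral_le (hmeas n) μ' μ
  rw [integral_iterate_transOp hμ hf hw hm] at hend
  simp only [Function.iterate_zero, id_eq] at htel
  linarith

lemma summable_houseLaw_contCoeff {q : Kernel (ℕ → E) E} [IsMarkovKernel q]
    (h0 : contCoeff q 0 < 1) (hsum : Summable (contCoeff q)) :
    Summable fun n => houseLaw (contCoeff q) n 0 :=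
  summable_houseLaw_zero (contCoeff_nonneg q) h0 (antitone_contCoeff q) hsum

lemma tendsto_iterate_houseStep_cylinderOsc {b : ℕ → ℝ}
    (hu : Summable fun n => houseLaw b n 0) (k : ℕ) :
    Tendsto (fun n => (houseStep b)^[n] (cylinderOsc k) 0) atTop (𝓝 0) :=
  tendsto_iterate_houseStep hu (k := k) fun j hj => by simp [cylinderOsc, hj]

/-- The comparison with `q' = q` and `δ = 0` leaves only the remainder, which vanishes by
transience. -/
lemma invariant_unique {q : Kernel (ℕ → E) E} [IsMarkovKernel q]
    (hu : Summable fun n => houseLaw (contCoeff q) n 0) {μ μ' : Measure (ℕ → E)}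
    [IsProbabilityMeasure μ] [IsProbabilityMeasure μ'] (hμ : (pastKernel q).Invariant μ)
    (hμ' : (pastKernel q).Invariant μ') : μ = μ' := by
  refine measure_ext_of_integral_hasOsc fun k f hm hf => ?_
  have key : ∀ {μ μ' : Measure (ℕ → E)} [IsProbabilityMeasure μ] [IsProbabilityMeasure μ'],
      (pastKernel q).Invariant μ → (pastKernel q).Invariant μ' →
      ∫ y, f y ∂μ' ≤ ∫ y, f y ∂μ := by
    intro μ μ' _ _ hμ hμ'
    refine sub_nonpos.1 (ge_of_tendsto' (tendsto_iterate_houseStep_cylinderOsc hu k) fun n => ?_)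
    simpa using integral_sub_integral_le_of_invariant hμ hμ' hf (antitone_cylinderOsc k) hm
      (fun y => (dTV_self (q y)).le) n
  exact le_antisymm (key hμ' hμ) (key hμ hμ')

lemma tendsto_cylinderOsc (k : ℕ) : Tendsto (cylinderOsc k) atTop (𝓝 0) :=
  tendsto_const_nhds.congr' ((eventually_ge_atTop k).mono fun j hj => by
    simp [cylinderOsc, hj])

lemma tendsto_houseStep {b w : ℕ → ℝ} (hb : Tendsto b atTop (𝓝 0))
    (hw : Tendsto w atTop (𝓝 0)) : Tendsto (houseStep b w) atTop (𝓝 0) := by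
  have h := ((hb.const_sub 1).mul ((tendsto_add_atTop_iff_nat 1).2 hw)).add (hb.mul_const (w 0))
  simp only [sub_zero, mul_zero, zero_mul, add_zero] at h
  exact h

/-- Run the chain from a fixed past and take a limit along an ultrafilter. No Cesàro averaging is
needed, as `T^(n+1) f - T^n f` is bounded by the vanishing oscillation of `T^n f`. -/
lemma exists_invariant {q : Kernel (ℕ → E) E} [IsMarkovKernel q]
    (hb : Tendsto (contCoeff q) atTop (𝓝 0))
    (hu : Summable fun n => houseLaw (contCoeff q) n 0) :
    ∃ μ : Measure (ℕ → E), IsProbabilityMeasure μ ∧ (pastKernel q).Invariant μ := by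
  let y₀ : ℕ → E := fun _ => Classical.arbitrary E
  let μ : ℕ → Measure (ℕ → E) := fun n => (fun ν => ν.bind (pastKernel q))^[n] (Measure.dirac y₀)
  have hsucc : ∀ n, μ (n + 1) = (μ n).bind (pastKernel q) := fun n =>
    Function.iterate_succ_apply' _ _ _
  have hprob : ∀ n, IsProbabilityMeasure (μ n) := by
    intro n
    induction n with
    | zero => exact Measure.dirac.isProbabilityMeasure
    | succ n ih => rw [hsucc]; infer_instance
  have hint : ∀ n (f : (ℕ → E) → ℝ) w, HasOsc f w → Antitone w → Measurable f →
      ∫ y, f y ∂μ n = (transOp q)^[n] f y₀ := by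
    intro n
    induction n with
    | zero =>
      intro f w hf hw hm
      exact integral_dirac' _ _ hm.stronglyMeasurable
    | succ n ih =>
      intro f w hf hw hm
      rw [hsucc, integral_bind_pastKernel q (μ n) hf hm, ih _ _ (hf.map q hw)
        (antitone_iterate_houseStep_contCoeff q hw 1) (measurable_transOp q hm),
        Function.iterate_succ_apply]
  obtain ⟨ν, hν, hlim⟩ := exists_tendsto_integral_hyperfilter μ
  refine ⟨ν, hν, ?_⟩
  refine measure_ext_of_integral_hasOsc fun k f hm hf => ?_
  have hw := antitone_cylinderOsc k
  rw [integral_bind_pastKernel q ν hf hm]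
  have h1 := hlim f fun ε hε => hf.exists_finset (tendsto_cylinderOsc k) hε
  -- `transOp q f` need not be local; `b m → 0` makes it a uniform limit of local functions.
  have h2 := hlim (transOp q f) fun ε hε =>
    (hf.map q hw).exists_finset (tendsto_houseStep hb (tendsto_cylinderOsc k)) hε
  have h3 : Tendsto (fun n => ∫ y, transOp q f y ∂μ n - ∫ y, f y ∂μ n) (hyperfilter ℕ)
      (𝓝 0) := by
    refine squeeze_zero_norm (fun n => ?_)
      ((tendsto_iterate_houseStep_cylinderOsc hu k).mono_left Nat.hyperfilter_le_atTop)
    rw [hint n _ _ hf hw hm, hint n _ _ (hf.map q hw)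
      (antitone_iterate_houseStep_contCoeff q hw 1) (measurable_transOp q hm),
      ← Function.iterate_succ_apply, Function.iterate_succ_apply']
    exact abs_transOp_sub_le q (hf.iterate q hw n) y₀
  exact sub_eq_zero.1 (tendsto_nhds_unique (h2.sub h1) h3)

end Invariant

/-! ### Stationary chains and invariant laws of the past -/

section Past

variable {Ω E : Type*}

lemma past_add_one (Y : ℤ → Ω → E) (t : ℤ) (ω : Ω) :
    past Y (t + 1) ω = pastCons (Y t ω) (past Y t ω) := by
  funext j
  cases j with
  | zero => simp [past]
  | succ j =>
    simp only [past, pastCons_succ, Nat.cast_add, Nat.cast_one]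
    congr 1
    ring

variable [MeasurableSpace Ω] [MeasurableSpace E]

lemma measurable_past {Y : ℤ → Ω → E} (hY : ∀ t, Measurable (Y t)) (t : ℤ) :
    Measurable (past Y t) :=
  measurable_pi_lambda _ fun _ => hY _

lemma measurable_past_eval (t : ℤ) :
    Measurable (past (fun (t : ℤ) (ω : ℤ → E) => ω t) t) :=
  measurable_past (fun t => measurable_pi_apply t) t

/-- The law of a process indexed by `ℤ` is determined by the laws of its pasts. -/
lemma measure_ext_of_map_past {ν ν' : Measure (ℤ → E)} [IsFiniteMeasure ν']
    (h : ∀ t, ν.map (past (fun (t : ℤ) (ω : ℤ → E) => ω t) t) =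
      ν'.map (past (fun (t : ℤ) (ω : ℤ → E) => ω t) t)) : ν = ν' := by
  refine measure_ext_of_map_restrict fun I => ?_
  obtain ⟨M, hM⟩ := I.bddAbove
  -- Time `i ≤ M` is entry `M - i` of the past at `M + 1`.
  let g : (ℕ → E) → I → E := fun y i => y (M - i).toNat
  have hg : Measurable g := measurable_pi_lambda _ fun i => measurable_pi_apply _
  have hfac : (I.restrict : (ℤ → E) → I → E) =
      g ∘ past (fun (t : ℤ) (ω : ℤ → E) => ω t) (M + 1) := by
    funext ω i
    have hi : (i : ℤ) ≤ M := hM i.2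
    simp only [Finset.restrict, Function.comp_apply, g, past]
    congr 1
    omega
  rw [hfac, ← Measure.map_map hg (measurable_past_eval _),
    ← Measure.map_map hg (measurable_past_eval _), h]

lemma IsStationaryChain.map_past_eq {q : Kernel (ℕ → E) E} {P : Measure Ω} {Y : ℤ → Ω → E}
    (h : IsStationaryChain q P Y) (t s : ℤ) : P.map (past Y t) = P.map (past Y s) := by
  have key : ∀ t, P.map (past Y t) =
      (P.map fun ω t => Y t ω).map (past (fun (t : ℤ) (ω : ℤ → E) => ω t) 0) := by
    intro t
    rw [← h.stationary t, Measure.map_map (measurable_past_eval 0)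
      (measurable_pi_lambda _ fun s => h.measurable _)]
    congr 1
    funext ω j
    simp only [past, Function.comp_apply]
    congr 1
    ring
  rw [key t, key s]

lemma IsStationaryChain.isProbabilityMeasure_map_past {q : Kernel (ℕ → E) E}
    {P : Measure Ω} {Y : ℤ → Ω → E} (h : IsStationaryChain q P Y) (t : ℤ) :
    IsProbabilityMeasure (P.map (past Y t)) :=
  have := h.isProbabilityMeasure
  Measure.isProbabilityMeasure_map (measurable_past h.measurable t).aemeasurable

/-- The law of `Y 0` in terms of the law of the past up to time `0`. -/
lemma map_real_eq_integral_indicator {P : Measure Ω} {Y : ℤ → Ω → E}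
    (hY : ∀ t, Measurable (Y t)) {A : Set E} (hA : MeasurableSet A) :
    (P.map (Y 0)).real A =
      ∫ y, ((fun y : ℕ → E => y 0) ⁻¹' A).indicator (fun _ => (1 : ℝ)) y ∂P.map (past Y 1) := by
  have hs : MeasurableSet ((fun y : ℕ → E => y 0) ⁻¹' A) := measurable_pi_apply 0 hA
  rw [map_measureReal_apply (hY 0) hA]
  refine Eq.trans ?_ (integral_indicator_one hs).symm
  rw [map_measureReal_apply (measurable_past hY 1) hs]
  rfl

variable [Fintype E] [DiscreteMeasurableSpace E]

lemma IsStationaryChain.map_past_add_one {q : Kernel (ℕ → E) E} [IsMarkovKernel q]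
    {P : Measure Ω} {Y : ℤ → Ω → E} (h : IsStationaryChain q P Y) (t : ℤ) :
    P.map (past Y (t + 1)) = (P.map (past Y t)).bind (pastKernel q) := by
  classical
  have := h.isProbabilityMeasure
  have hpast := measurable_past h.measurable
  have : ∀ t, IsProbabilityMeasure (P.map (past Y t)) := fun t =>
    Measure.isProbabilityMeasure_map (hpast t).aemeasurable
  refine measure_ext_of_integral_hasOsc fun k f hm hf => ?_
  rw [integral_bind_pastKernel q _ hf hm,
    integral_map (hpast _).aemeasurable hm.aestronglyMeasurable,
    integral_map (hpast _).aemeasurable (measurable_transOp q hm).aestronglyMeasurable]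
  obtain ⟨C, hC⟩ := hf.exists_abs_le
  let X : E → Ω → ℝ := fun e => (Y t ⁻¹' {e}).indicator fun _ => 1
  let g : E → Ω → ℝ := fun e ω => f (pastCons e (past Y t ω))
  -- Splitting by the value of `Y t` leaves factors `g e` measurable for the past, which can be
  -- pulled out of the conditional expectation.
  have hsplit : ∀ ω, f (past Y (t + 1) ω) = ∑ e, (X e * g e) ω := by
    intro ω
    rw [Finset.sum_eq_single (Y t ω)]
    · simp [X, g, past_add_one]
    · intro e _ he
      simp [X, Set.indicator_of_notMem, Ne.symm he]
    · simp
  have hXm : ∀ e, Measurable (X e) := fun e =>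
    measurable_const.indicator (h.measurable t (measurableSet_singleton e))
  have hgm : ∀ e, Measurable (g e) := fun e =>
    hm.comp ((measurable_pastCons e).comp (hpast t))
  have hX : ∀ e, Integrable (X e) P := fun e =>
    (integrable_const 1).indicator (h.measurable t (measurableSet_singleton e))
  have hXg : ∀ e, Integrable (X e * g e) P := fun e =>
    (hX e).mul_bdd (hgm e).aestronglyMeasurable (ae_of_all _ fun ω => hC _)
  have hqm : ∀ e, Measurable fun ω => (q (past Y t ω)).real {e} := fun e =>
    ((q.measurable_coe (measurableSet_singleton e)).ennreal_toReal).comp (hpast t)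
  have hq : ∀ e, Integrable (fun ω => (q (past Y t ω)).real {e} * g e ω) P := fun e =>
    Integrable.of_bound ((hqm e).mul (hgm e)).aestronglyMeasurable C (ae_of_all _ fun ω => by
      rw [norm_mul]
      exact (mul_le_of_le_one_left (norm_nonneg _)
        (by rw [Real.norm_of_nonneg measureReal_nonneg]; exact measureReal_le_one)).trans (hC _))
  simp_rw [hsplit, transOp]
  rw [integral_finsetSum _ fun e _ => hXg e, integral_finsetSum _ fun e _ => hq e]
  refine Finset.sum_congr rfl fun e _ => ?_
  have hle : MeasurableSpace.comap (past Y t) inferInstance ≤ ‹MeasurableSpace Ω› :=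
    (hpast t).comap_le
  have hgs : StronglyMeasurable[MeasurableSpace.comap (past Y t) inferInstance] (g e) :=
    ((hm.comp (measurable_pastCons e)).comp (comap_measurable _)).stronglyMeasurable
  rw [← integral_condExp hle]
  refine integral_congr_ae ?_
  filter_upwards [condExp_mul_of_stronglyMeasurable_right hgs (hXg e) (hX e), h.transition t e]
    with ω h1 h2
  rw [h1, Pi.mul_apply, h2]

lemma IsStationaryChain.invariant_map_past {q : Kernel (ℕ → E) E} [IsMarkovKernel q]
    {P : Measure Ω} {Y : ℤ → Ω → E} (h : IsStationaryChain q P Y) (t : ℤ) :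
    (pastKernel q).Invariant (P.map (past Y t)) :=
  (h.map_past_add_one t).symm.trans (h.map_past_eq _ _)

lemma IsStationaryChain.unique [Nonempty E] {q : Kernel (ℕ → E) E} [IsMarkovKernel q]
    (hu : Summable fun n => houseLaw (contCoeff q) n 0) {ν ν' : Measure (ℤ → E)}
    (h : IsStationaryChain q ν fun t ω => ω t) (h' : IsStationaryChain q ν' fun t ω => ω t) :
    ν = ν' := by
  have := h'.isProbabilityMeasure
  refine measure_ext_of_map_past fun t => ?_
  have := h.isProbabilityMeasure_map_past t
  have := h'.isProbabilityMeasure_map_past t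
  exact invariant_unique hu (h.invariant_map_past t) (h'.invariant_map_past t)

end Past

/-! ### From invariant laws of the past to stationary chains -/

section Existence

variable {E : Type*} [MeasurableSpace E] [Fintype E] [DiscreteMeasurableSpace E]

/-- A process all of whose pasts are distributed according to an invariant law is a stationary
chain. -/
lemma isStationaryChain_of_map_past {q : Kernel (ℕ → E) E} [IsMarkovKernel q]
    {μ : Measure (ℕ → E)} [IsProbabilityMeasure μ] (hμ : (pastKernel q).Invariant μ)
    {ν : Measure (ℤ → E)} [IsProbabilityMeasure ν]
    (hν : ∀ t, ν.map (past (fun (t : ℤ) (ω : ℤ → E) => ω t) t) = μ) :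
    IsStationaryChain q ν fun t ω => ω t where
  isProbabilityMeasure := inferInstance
  measurable t := measurable_pi_apply t
  stationary k := by
    have hk : Measurable fun (ω : ℤ → E) (t : ℤ) => ω (t + k) :=
      measurable_pi_lambda _ fun t => measurable_pi_apply _
    have hid : (fun (ω : ℤ → E) (t : ℤ) => ω t) = id := rfl
    rw [hid, Measure.map_id]
    refine measure_ext_of_map_past fun t => ?_
    rw [Measure.map_map (measurable_past_eval t) hk, hν t, ← hν (t + k)]
    congr 1
    funext ω j
    simp only [past, Function.comp_apply]
    congr 1
    ring
  transition t e := by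
    have hpast := measurable_past_eval (E := E) t
    set p := past (fun (t : ℤ) (ω : ℤ → E) => ω t) t with hp
    have he : MeasurableSet ((fun ω : ℤ → E => ω t) ⁻¹' {e}) :=
      measurable_pi_apply t (measurableSet_singleton e)
    have hqm : Measurable fun y => (q y).real {e} :=
      (q.measurable_coe (measurableSet_singleton e)).ennreal_toReal
    have hqint : Integrable (fun ω => (q (p ω)).real {e}) ν :=
      Integrable.of_bound (hqm.comp hpast).aestronglyMeasurable 1 (ae_of_all _ fun ω => by
        rw [Real.norm_of_nonneg measureReal_nonneg]; exact measureReal_le_one)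
    refine (ae_eq_condExp_of_forall_setIntegral_eq hpast.comap_le
      ((integrable_const 1).indicator he) (fun s _ _ => hqint.integrableOn) ?_
      (hqm.comp (comap_measurable p)).stronglyMeasurable.aestronglyMeasurable).symm
    rintro _ ⟨A, hA, rfl⟩ -
    have htail : Measurable fun (y : ℕ → E) (j : ℕ) => y (j + 1) :=
      measurable_pi_lambda _ fun j => measurable_pi_apply _
    -- `B` is the event "letter `e`, preceded by a past in `A`", read at time `t + 1`. Its `transOp`
    -- image is `q(e|·)` on `A`, so invariance of `μ` is the required identity.
    let B : Set (ℕ → E) := (fun y => y 0) ⁻¹' {e} ∩ (fun y j => y (j + 1)) ⁻¹' A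
    have hB : MeasurableSet B :=
      (measurable_pi_apply 0 (measurableSet_singleton e)).inter (htail hA)
    have hlhs : ∫ ω in p ⁻¹' A, (q (p ω)).real {e} ∂ν = ∫ y in A, (q y).real {e} ∂μ := by
      rw [← hν t, setIntegral_map hA hqm.aestronglyMeasurable hpast.aemeasurable]
    have hpre : past (fun (t : ℤ) (ω : ℤ → E) => ω t) (t + 1) ⁻¹' B =
        ((fun ω : ℤ → E => ω t) ⁻¹' {e}) ∩ p ⁻¹' A := by
      ext ω
      simp [B, past_add_one, hp]
    have hrhs : ∫ ω in p ⁻¹' A, ((fun ω : ℤ → E => ω t) ⁻¹' {e}).indicator (fun _ => (1 : ℝ)) ω ∂ν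
        = μ.real B := by
      rw [setIntegral_indicator he, Set.inter_comm, ← hpre, ← hν (t + 1),
        map_measureReal_apply (measurable_past_eval _) hB]
      simp
    have hop : transOp q (B.indicator fun _ => 1) = A.indicator fun y => (q y).real {e} := by
      funext y
      rw [transOp, Finset.sum_eq_single e]
      · by_cases hy : y ∈ A <;> simp [B, hy, Set.indicator]
      · intro e' _ he'
        simp [B, he', Set.indicator]
      · simp
    rw [hlhs, hrhs, ← integral_indicator hA, ← hop,
      ← integral_bind_pastKernel q μ (hasOsc_indicator_const B) (measurable_const.indicator hB),
      hμ.def]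
    exact integral_indicator_one hB

/-- Adding a letter and then deleting it does nothing, and by invariance the addition is free. -/
lemma map_tail_eq_of_invariant {q : Kernel (ℕ → E) E} [IsMarkovKernel q]
    {μ : Measure (ℕ → E)} [IsProbabilityMeasure μ] (hμ : (pastKernel q).Invariant μ) (n : ℕ) :
    μ.map (fun y j => y (j + n)) = μ := by
  have hmeas : ∀ n, Measurable fun (y : ℕ → E) (j : ℕ) => y (j + n) := fun n =>
    measurable_pi_lambda _ fun j => measurable_pi_apply _
  have hone : μ.map (fun y j => y (j + 1)) = μ := by
    have : IsProbabilityMeasure (μ.map fun y j => y (j + 1)) :=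
      Measure.isProbabilityMeasure_map (hmeas 1).aemeasurable
    refine measure_ext_of_integral_hasOsc fun k f hm hf => ?_
    have hf' : HasOsc (fun y : ℕ → E => f fun j => y (j + 1)) fun _ => cylinderOsc k 0 :=
      fun m y y' _ => hf 0 _ _ (by simp)
    rw [integral_map (hmeas 1).aemeasurable hm.aestronglyMeasurable]
    conv_lhs => rw [← hμ.def]
    rw [integral_bind_pastKernel q μ hf' (hm.comp (hmeas 1))]
    refine integral_congr_ae (ae_of_all _ fun y => ?_)
    simp only [transOp, pastCons_succ]
    rw [← Finset.sum_mul, sum_real_singleton, one_mul]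
  induction n with
  | zero => exact Measure.map_id
  | succ n ih =>
    conv_rhs => rw [← ih, ← hone]
    rw [Measure.map_map (hmeas n) (hmeas 1)]
    rfl

lemma exists_isStationaryChain [Nonempty E] {q : Kernel (ℕ → E) E} [IsMarkovKernel q]
    (hb : Tendsto (contCoeff q) atTop (𝓝 0))
    (hu : Summable fun n => houseLaw (contCoeff q) n 0) :
    ∃ ν : Measure (ℤ → E), IsStationaryChain q ν fun t ω => ω t := by
  obtain ⟨μ, _, hμ⟩ := exists_invariant hb hu
  -- `φ n` reads `y` as a trajectory up to time `n`, frozen at `y 0` afterwards. For `n ≥ t` its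
  -- past at `t` is `y` shifted by `n + 1 - t`, again with law `μ`.
  let φ : ℕ → (ℕ → E) → ℤ → E := fun n y t => y (n - t).toNat
  have hφ : ∀ n, Measurable (φ n) := fun n =>
    measurable_pi_lambda _ fun t => measurable_pi_apply _
  have : ∀ n, IsProbabilityMeasure (μ.map (φ n)) := fun n =>
    Measure.isProbabilityMeasure_map (hφ n).aemeasurable
  obtain ⟨ν, _, hlim⟩ := exists_tendsto_integral_hyperfilter fun n => μ.map (φ n)
  refine ⟨ν, isStationaryChain_of_map_past hμ fun t => ?_⟩
  have hpast := measurable_past_eval (E := E) t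
  have : IsProbabilityMeasure (ν.map (past (fun (t : ℤ) (ω : ℤ → E) => ω t) t)) :=
    Measure.isProbabilityMeasure_map hpast.aemeasurable
  refine measure_ext_of_integral_hasOsc fun k f hm hf => ?_
  rw [integral_map hpast.aemeasurable hm.aestronglyMeasurable]
  refine tendsto_nhds_unique (hlim _ fun ε hε => ?_) (tendsto_const_nhds.congr' ?_)
  · obtain ⟨I, hI⟩ := hf.exists_finset (tendsto_cylinderOsc k) hε
    refine ⟨I.image fun j : ℕ => t - 1 - j, fun x y hxy => hI _ _ fun j hj => ?_⟩
    exact hxy _ (Finset.mem_image_of_mem _ hj)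
  · refine Filter.Eventually.filter_mono Nat.hyperfilter_le_atTop ?_
    filter_upwards [eventually_ge_atTop t.toNat] with n hn
    rw [integral_map (hφ n).aemeasurable
      (f := fun x => f (past (fun (t : ℤ) (ω : ℤ → E) => ω t) t x))
      (hm.comp hpast).aestronglyMeasurable]
    conv_lhs => rw [← map_tail_eq_of_invariant hμ (n + 1 - t).toNat]
    rw [integral_map (measurable_pi_lambda _ fun j => measurable_pi_apply _).aemeasurable
      hm.aestronglyMeasurable]
    refine integral_congr_ae (ae_of_all _ fun y => ?_)
    simp only [φ]
    congr 1
    funext j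
    congr 1
    omega

lemma existsUnique_isStationaryChain [Nonempty E] {q : Kernel (ℕ → E) E} [IsMarkovKernel q]
    (hb : Tendsto (contCoeff q) atTop (𝓝 0))
    (hu : Summable fun n => houseLaw (contCoeff q) n 0) :
    ∃! ν : Measure (ℤ → E), IsStationaryChain q ν fun t ω => ω t :=
  existsUnique_of_exists_of_unique (exists_isStationaryChain hb hu) fun _ _ h h' => h.unique hu h'

end Existence

/-! ### The perturbation bound -/

section Perturbation

variable {E : Type*} [MeasurableSpace E] [Fintype E] [DiscreteMeasurableSpace E] [Nonempty E]

/-- The perturbation bound for the one-dimensional marginals of two stationary chains. -/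
lemma IsStationaryChain.dTV_map_le {Ω Ω' : Type*} [MeasurableSpace Ω] [MeasurableSpace Ω']
    {q q' : Kernel (ℕ → E) E} [IsMarkovKernel q] [IsMarkovKernel q']
    (hu : Summable fun n => houseLaw (contCoeff q) n 0)
    {P : Measure Ω} {P' : Measure Ω'} {Y : ℤ → Ω → E} {Y' : ℤ → Ω' → E}
    (h : IsStationaryChain q P Y) (h' : IsStationaryChain q' P' Y') :
    dTV (P.map (Y 0)) (P'.map (Y' 0)) ≤
      (∑' n, houseLaw (contCoeff q) n 0) * ⨆ y : ℕ → E, dTV (q y) (q' y) := by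
  have := h.isProbabilityMeasure
  have := h'.isProbabilityMeasure
  have := Measure.isProbabilityMeasure_map (μ := P) (h.measurable 0).aemeasurable
  have := Measure.isProbabilityMeasure_map (μ := P') (h'.measurable 0).aemeasurable
  have := h.isProbabilityMeasure_map_past 1
  have := h'.isProbabilityMeasure_map_past 1
  have hδ : ∀ y, dTV (q y) (q' y) ≤ ⨆ y : ℕ → E, dTV (q y) (q' y) :=
    le_ciSup ⟨1, by rintro _ ⟨y, rfl⟩; exact dTV_le_one _ _⟩
  rw [dTV_comm]
  refine dTV_le_of_forall fun A => ?_
  let s : Set (ℕ → E) := (fun y => y 0) ⁻¹' A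
  have hs : MeasurableSet s := measurable_pi_apply 0 (MeasurableSet.of_discrete)
  have hosc : HasOsc (s.indicator fun _ => (1 : ℝ)) (cylinderOsc 1) :=
    hasOsc_indicator fun y y' hy hys => by simpa [s, ← hy 0 one_pos] using hys
  -- `cylinderOsc 1` is the indicator of the state `0`.
  have hit : ∀ n, (houseStep (contCoeff q))^[n] (cylinderOsc 1) 0 =
      houseLaw (contCoeff q) n 0 := fun n => by
    rw [iterate_houseStep_zero, Finset.sum_range_succ']
    simp [cylinderOsc]
  have hbound := integral_sub_integral_le_of_invariant (h.invariant_map_past 1)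
    (h'.invariant_map_past 1) hosc (antitone_cylinderOsc 1) (measurable_const.indicator hs) hδ
  simp_rw [hit] at hbound
  rw [map_real_eq_integral_indicator h.measurable MeasurableSet.of_discrete,
    map_real_eq_integral_indicator h'.measurable MeasurableSet.of_discrete, mul_comm]
  have hlim := (hu.hasSum.tendsto_sum_nat.const_mul (⨆ y : ℕ → E, dTV (q y) (q' y))).add
    hu.tendsto_atTop_zero
  rw [add_zero] at hlim
  exact ge_of_tendsto' hlim hbound

end Perturbation

end CompleteConnections

end

theorem corollary1 {E : Type*} [Fintype E] [Nonempty E] [MeasurableSpace E]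
    [DiscreteMeasurableSpace E]
    (q qbar : ProbabilityTheory.Kernel (ℕ → E) E)
    [ProbabilityTheory.IsMarkovKernel q] [ProbabilityTheory.IsMarkovKernel qbar]
    (hq₁ : CompleteConnections.PositiveKernel q)
    (hq₂ : CompleteConnections.ContinuousKernel q)
    (hqbar₁ : CompleteConnections.PositiveKernel qbar)
    (hqbar₂ : CompleteConnections.ContinuousKernel qbar)
    (hsum : Summable fun m : ℕ =>
      CompleteConnections.contCoeff q (m + 1) + CompleteConnections.contCoeff qbar (m + 1)) :
    -- the stationary chains exist and are unique in law
    (∃! ν : MeasureTheory.Measure (ℤ → E),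
      CompleteConnections.IsStationaryChain q ν (fun t ω => ω t)) ∧
    (∃! ν : MeasureTheory.Measure (ℤ → E),
      CompleteConnections.IsStationaryChain qbar ν (fun t ω => ω t)) ∧
    -- the perturbation bound, with a finite constant
    Summable (CompleteConnections.bStar (CompleteConnections.contCoeff q)) ∧
    (∀ {Ω Ωbar : Type*} [MeasurableSpace Ω] [MeasurableSpace Ωbar]
      (P : MeasureTheory.Measure Ω) (Pbar : MeasureTheory.Measure Ωbar)
      (Y : ℤ → Ω → E) (Ybar : ℤ → Ωbar → E),
      CompleteConnections.IsStationaryChain q P Y →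
      CompleteConnections.IsStationaryChain qbar Pbar Ybar →
      CompleteConnections.dTV (P.map (Y 0)) (Pbar.map (Ybar 0)) ≤
        (1 + ∑' m : ℕ, CompleteConnections.bStar (CompleteConnections.contCoeff q) m) *
          ⨆ y : ℕ → E, CompleteConnections.dTV (q y) (qbar y)) ∧
    -- the Markov case: `q` depends on the most recent coordinate only
    ((∀ y y' : ℕ → E, y 0 = y' 0 → q y = q y') →
      (∀ m : ℕ, 1 ≤ m → CompleteConnections.contCoeff q m = 0) ∧
      (∀ m : ℕ, 1 ≤ m → CompleteConnections.bStar (CompleteConnections.contCoeff q) m =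
        CompleteConnections.contCoeff q 0 ^ m) ∧
      1 + ∑' m : ℕ, CompleteConnections.bStar (CompleteConnections.contCoeff q) (m + 1) =
        (1 - CompleteConnections.contCoeff q 0)⁻¹ ∧
      (∀ {Ω Ωbar : Type*} [MeasurableSpace Ω] [MeasurableSpace Ωbar]
        (P : MeasureTheory.Measure Ω) (Pbar : MeasureTheory.Measure Ωbar)
        (Y : ℤ → Ω → E) (Ybar : ℤ → Ωbar → E),
        CompleteConnections.IsStationaryChain q P Y →
        CompleteConnections.IsStationaryChain qbar Pbar Ybar →
        CompleteConnections.dTV (P.map (Y 0)) (Pbar.map (Ybar 0)) ≤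
          (1 - CompleteConnections.contCoeff q 0)⁻¹ *
            ⨆ y : ℕ → E, CompleteConnections.dTV (q y) (qbar y))) := by
  have hsq : Summable (CompleteConnections.contCoeff q) :=
    (summable_nat_add_iff 1).1 (hsum.of_nonneg_of_le
      (fun m => CompleteConnections.contCoeff_nonneg q _)
      fun m => le_add_of_nonneg_right (CompleteConnections.contCoeff_nonneg qbar _))
  have hsqbar : Summable (CompleteConnections.contCoeff qbar) :=
    (summable_nat_add_iff 1).1 (hsum.of_nonneg_of_le
      (fun m => CompleteConnections.contCoeff_nonneg qbar _)
      fun m => le_add_of_nonneg_left (CompleteConnections.contCoeff_nonneg q _))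
  have hu := CompleteConnections.summable_houseLaw_contCoeff hq₂.1 hsq
  have hubar := CompleteConnections.summable_houseLaw_contCoeff hqbar₂.1 hsqbar
  have htsum := CompleteConnections.tsum_houseLaw_zero hu
  have hstar := CompleteConnections.summable_bStar hu
  refine ⟨CompleteConnections.existsUnique_isStationaryChain hq₂.2 hu,
    CompleteConnections.existsUnique_isStationaryChain hqbar₂.2 hubar, hstar, ?_, ?_⟩
  · intro Ω Ωbar _ _ P Pbar Y Ybar hY hYbar
    refine (hY.dTV_map_le hu hYbar).trans (mul_le_mul_of_nonneg_right ?_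
      (Real.iSup_nonneg fun y => CompleteConnections.dTV_nonneg _ _))
    -- The constant obtained omits `b*_0`, which is nonnegative.
    rw [htsum, hstar.tsum_eq_zero_add]
    have : 0 ≤ CompleteConnections.bStar (CompleteConnections.contCoeff q) 0 :=
      CompleteConnections.contCoeff_nonneg q 0
    linarith
  · intro hmarkov
    have hb : ∀ m : ℕ, 1 ≤ m → CompleteConnections.contCoeff q m = 0 := fun m hm =>
      le_antisymm (CompleteConnections.contCoeff_le q fun y y' hy => by
        rw [hmarkov y y' (hy 0 hm), CompleteConnections.dTV_self])
        (CompleteConnections.contCoeff_nonneg q m)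
    have hlaw := CompleteConnections.houseLaw_zero_of_eq_zero hb
    have hgeom : ∑' n, CompleteConnections.houseLaw (CompleteConnections.contCoeff q) n 0 =
        (1 - CompleteConnections.contCoeff q 0)⁻¹ := by
      simp_rw [hlaw]
      exact tsum_geometric_of_lt_one (CompleteConnections.contCoeff_nonneg q 0) hq₂.1
    refine ⟨hb, fun m hm => ?_, htsum.symm.trans hgeom, ?_⟩
    · rw [CompleteConnections.bStar, if_neg (by omega), hlaw]
    · intro Ω Ωbar _ _ P Pbar Y Ybar hY hYbar
      exact hgeom ▸ hY.dTV_map_le hu hYbar
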